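/- Let $n\ge 0$. For each party $k\in\{1,\dots,n\}$ let $\mathcal H^{A_k}$, $\mathcal H^{I_k}$, $\mathcal H^{O_k}$ be finite-dimensional Hilbert spaces with fixed computational bases, $d_{O_k}=\dim\mathcal H^{O_k}\ge 1$, and write $\mathbf A=A_1\cdots A_n$, $\mathbf A'=I_1O_1\cdots I_nO_n$. For a system $X$ let ${}_XW=\frac{\mathbb 1^X}{d_X}\otimes\mathrm{Tr}_XW$ and ${}_{[1-X]}W=W-{}_XW$. An $n$-partite process matrix is an operator $W\ge 0$ on $\mathcal H^{\mathbf A'}$ with $\mathrm{Tr}\,W=\prod_k d_{O_k}$ and ${}_{\prod_{k\in K}[1-O_k]\,\prod_{k\notin K}I_kO_k}W=0$ for every nonempty $K\subseteq\{1,\dots,n\}$. A local quantum instrument of party $k$ is a finite family $(M_{a_k})_{a_k}$ of positive semidefinite (Choi) operators on $\mathcal H^{A_k}\otimes\mathcal H^{I_k}\otimes\mathcal H^{O_k}$ with $\mathrm{Tr}_{O_k}\sum_{a_k}M_{a_k}=\mathbb 1^{A_kI_k}$. The link product is $M*N=\mathrm{Tr}_Y[(M^{T_Y}\otimes\mathbb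 1^Z)(\mathbb 1^X\otimes N)]$ for $M$ on $\mathcal H^{XY}$ and $N$ on $\mathcal H^{YZ}$. A POVM is a finite family of positive semidefinite operators summing to the identity; it is a projective measurement if all its elements are idempotent. (1) For every $n$-partite process matrix $W$ and all local quantum instruments $(M_{a_k})_{a_k}$, $k=1,\dots,n$, the operators $E_{\mathbf a}=\big(\bigotimes_k M_{a_k}\big)*W$ on $\mathcal H^{\mathbf A}$, $\mathbf a=(a_1,\dots,a_n)$, form a POVM. (2) Let $\mathcal X_k$ and $\mathcal A_k\neq\emptyset$ be finite sets, let $\mathcal H^{I_k}$ and $\mathcal H^{O_k}$ have computational bases indexed by $\mathcal X_k$ and $\mathcal A_k$, and let $\mathbf w=(w_k)_k$, $w_k:\prod_j\mathcal A_j\to\mathcal X_k$, be a process function: for every choice of maps $f_k:\mathcal X_k\to\mathcal A_k$, with $\mathbf f=(f_k)_k$, the map $\mathbf w\circ\mathbf f$ has exactly one fixed point (so that $w_k(\mathbf a)=w_k(\mathbf a_{\backslash k})$ does not depend on $a_k$). Then $$W_{\mathbf w}=\sum_{\mathbf a}\bigotimes_k|w_k(\mathbf a_{\backslash k})\rangle\langle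 w_k(\mathbf a_{\backslash k})|^{I_k}\otimes|a_k\rangle\langle a_k|^{O_k}$$ is an $n$-partite process matrix. If moreover $(M_{a_k|x_k})_{a_k\in\mathcal A_k}$ is a projective measurement on $\mathcal H^{A_k}$ for each $k$ and $x_k\in\mathcal X_k$, then the operators $M_{a_k}=\sum_{x_k}M_{a_k|x_k}\otimes|x_k\rangle\langle x_k|^{I_k}\otimes|a_k\rangle\langle a_k|^{O_k}$ form a local quantum instrument for each $k$, the operators $E_{\mathbf a}=\big(\bigotimes_kM_{a_k}\big)*W_{\mathbf w}$ satisfy $E_{\mathbf a}=\bigotimes_kM_{a_k|w_k(\mathbf a_{\backslash k})}$ for all $\mathbf a$, and $(E_{\mathbf a})_{\mathbf a}$ is a projective measurement on $\mathcal H^{\mathbf A}$. -/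

import Mathlib

open scoped ComplexOrder Kronecker

/-! All Hilbert spaces are finite dimensional and carry a fixed computational basis; a space is
given by the index type of that basis, and an operator by its matrix. -/

namespace ProcessMatrix

section Generic

/-- The tensor product `⨂ₖ Tₖ` of operators on the spaces with bases `d k`, as an operator on the
space with basis `∀ k, d k`. -/
def tensor {n : ℕ} {d : Fin n → Type*} (T : ∀ k, Matrix (d k) (d k) ℂ) :
    Matrix (∀ k, d k) (∀ k, d k) ℂ :=
  Matrix.of fun p q => ∏ k, T k (p k) (q k)

/-- A positive-operator-valued measure with finitely many outcomes. -/
structure IsPOVM {R d : Type*} [Fintype R] [DecidableEq d] (E : R → Matrix d d ℂ) : Prop where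
  posSemidef : ∀ a, (E a).PosSemidef
  sum_eq_one : ∑ a, E a = 1

/-- A projective measurement: a POVM all of whose elements are projectors.  (Elements that belong
to distinct outcomes are then automatically orthogonal.) -/
structure IsPVM {R d : Type*} [Fintype R] [Fintype d] [DecidableEq d]
    (E : R → Matrix d d ℂ) : Prop extends IsPOVM E where
  idempotent : ∀ a, E a * E a = E a

/-- The partial transpose `M^{T_Y}` of an operator on `X ⊗ Y`. -/
def transposeRight {X Y : Type*} (M : Matrix (X × Y) (X × Y) ℂ) : Matrix (X × Y) (X × Y) ℂ :=
  Matrix.of fun p q => M (p.1, q.2) (q.1, p.2)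

/-- The partial trace `Tr_Y` of an operator on `X ⊗ Y ⊗ Z`. -/
def traceMiddle {X Y Z : Type*} [Fintype Y] (M : Matrix (X × Y × Z) (X × Y × Z) ℂ) :
    Matrix (X × Z) (X × Z) ℂ :=
  Matrix.of fun p q => ∑ y, M (p.1, y, p.2) (q.1, y, q.2)

/-- The link product `M * N = Tr_Y [(M^{T_Y} ⊗ 1^Z) (1^X ⊗ N)]`. -/
def linkProduct {X Y Z : Type*} [Fintype X] [Fintype Y] [Fintype Z] [DecidableEq X]
    [DecidableEq Z] (M : Matrix (X × Y) (X × Y) ℂ) (N : Matrix (Y × Z) (Y × Z) ℂ) :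
    Matrix (X × Z) (X × Z) ℂ :=
  traceMiddle
    (Matrix.reindex (Equiv.prodAssoc X Y Z) (Equiv.prodAssoc X Y Z)
        (transposeRight M ⊗ₖ (1 : Matrix Z Z ℂ))
      * ((1 : Matrix X X ℂ) ⊗ₖ N))

/-- The partial trace over the last factor of `A ⊗ (I ⊗ O)`. -/
def traceOut {A I O : Type*} [Fintype O] (M : Matrix (A × I × O) (A × I × O) ℂ) :
    Matrix (A × I) (A × I) ℂ :=
  Matrix.of fun p q => ∑ o, M (p.1, p.2, o) (q.1, q.2, o)

/-- The Choi operators `(M_a)_a` of a quantum instrument with inputs `A`, `I`, output `O` and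
outcomes `R`: each `M_a` is positive semidefinite, and `Tr_O ∑ₐ M_a = 1`. -/
structure IsInstrument {R A I O : Type*} [Fintype R] [Fintype O] [DecidableEq A]
    [DecidableEq I] (M : R → Matrix (A × I × O) (A × I × O) ℂ) : Prop where
  posSemidef : ∀ a, (M a).PosSemidef
  traceOut_sum : traceOut (∑ a, M a) = 1

end Generic

section Parties

variable {n : ℕ} {I O : Fin n → Type*}
  [∀ k, Fintype (I k)] [∀ k, DecidableEq (I k)] [∀ k, Fintype (O k)] [∀ k, DecidableEq (O k)]

/-- Trace-and-replace of the output system of party `k`: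
`W ↦ (1 / d) ⊗ Tr W`, trace and identity being on `O k`, with `d = dim O k`. -/
noncomputable def traceReplaceOut (k : Fin n) :
    Module.End ℂ (Matrix (∀ j, I j × O j) (∀ j, I j × O j) ℂ) where
  toFun W := Matrix.of fun p q =>
    if (p k).2 = (q k).2 then
      (Fintype.card (O k) : ℂ)⁻¹ *
        ∑ o, W (Function.update p k ((p k).1, o)) (Function.update q k ((q k).1, o))
    else 0
  map_add' V W := by
    ext p q
    by_cases h : (p k).2 = (q k).2 <;> simp [h, Finset.sum_add_distrib, mul_add]
  map_smul' c W := by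
    ext p q
    by_cases h : (p k).2 = (q k).2 <;> simp [h, ← Finset.mul_sum, mul_left_comm]

/-- Trace-and-replace of both the input and the output system of party `k`. -/
noncomputable def traceReplaceInOut (k : Fin n) :
    Module.End ℂ (Matrix (∀ j, I j × O j) (∀ j, I j × O j) ℂ) where
  toFun W := Matrix.of fun p q =>
    if p k = q k then
      (Fintype.card (I k × O k) : ℂ)⁻¹ *
        ∑ r, W (Function.update p k r) (Function.update q k r)
    else 0
  map_add' V W := by
    ext p q
    by_cases h : p k = q k <;> simp [h, Finset.sum_add_distrib, mul_add]
  map_smul' c W := by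
    ext p q
    by_cases h : p k = q k <;> simp [h, ← Finset.mul_sum, mul_left_comm]

/-- The map `W ↦ _{∏_{k ∈ K} [1 - O_k] ∏_{k ∉ K} I_k O_k} W`.  It is a composition of one map per
party; these maps act on different systems, so they commute and their order is irrelevant. -/
noncomputable def constraintMap (K : Finset (Fin n)) :
    Module.End ℂ (Matrix (∀ j, I j × O j) (∀ j, I j × O j) ℂ) :=
  ((List.finRange n).map fun k =>
    if k ∈ K then 1 - traceReplaceOut k else traceReplaceInOut k).prod

/-- `n`-partite process matrices on `⨂ₖ (I k ⊗ O k)`. -/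
structure IsProcessMatrix (W : Matrix (∀ j, I j × O j) (∀ j, I j × O j) ℂ) : Prop where
  posSemidef : W.PosSemidef
  constraint : ∀ K : Finset (Fin n), K.Nonempty → constraintMap K W = 0
  trace_eq : W.trace = ∏ k, (Fintype.card (O k) : ℂ)

/-- The Choi operator `M_a = ⨂ₖ M_{aₖ}` of a distributed instrument, with its tensor factors
reordered so that it acts on `(⨂ₖ A k) ⊗ ⨂ₖ (I k ⊗ O k)`. -/
def distributed {A R : Fin n → Type*}
    (M : ∀ k, R k → Matrix (A k × I k × O k) (A k × I k × O k) ℂ) (a : ∀ k, R k) :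
    Matrix ((∀ k, A k) × (∀ k, I k × O k)) ((∀ k, A k) × (∀ k, I k × O k)) ℂ :=
  (tensor fun k => M k (a k)).submatrix (fun p k => (p.1 k, p.2 k)) (fun p k => (p.1 k, p.2 k))

/-- The operators `E_a = M_a * W`.  Here `W` acts on the systems `I k`, `O k` only, so the third
space `Z` of the link product is one dimensional. -/
def effective {A R : Fin n → Type*} [∀ k, Fintype (A k)] [∀ k, DecidableEq (A k)]
    (M : ∀ k, R k → Matrix (A k × I k × O k) (A k × I k × O k) ℂ)
    (W : Matrix (∀ j, I j × O j) (∀ j, I j × O j) ℂ) (a : ∀ k, R k) :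
    Matrix (∀ k, A k) (∀ k, A k) ℂ :=
  Matrix.reindex (Equiv.prodPUnit _) (Equiv.prodPUnit _)
    (linkProduct (distributed M a)
      (Matrix.reindex (Equiv.prodPUnit.{0} _).symm (Equiv.prodPUnit.{0} _).symm W))

end Parties

section ProcessFunction

variable {n : ℕ} {X Out : Fin n → Type*}

/-- `w = (w_k)_k`, `w_k : ∏ⱼ Out j → X k`, is a process function: for all local operations
`f_k : X k → Out k`, the map `w ∘ f` has exactly one fixed point.  (Then `w_k` does not depend on
the output of party `k`.) -/
def IsProcessFunction (w : ∀ k, (∀ j, Out j) → X k) : Prop :=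
  ∀ f : ∀ k, X k → Out k, ∃! x : ∀ k, X k, ∀ k, w k (fun j => f j (x j)) = x k

/-- The process matrix of a process function,
`W_w = ∑ₐ ⨂ₖ |w_k(a)⟩⟨w_k(a)| ⊗ |a_k⟩⟨a_k|`, with inputs `X k` and outputs `Out k`. -/
def ofFunction [∀ k, DecidableEq (X k)] [∀ k, Fintype (Out k)] [∀ k, DecidableEq (Out k)]
    (w : ∀ k, (∀ j, Out j) → X k) :
    Matrix (∀ k, X k × Out k) (∀ k, X k × Out k) ℂ :=
  ∑ a : ∀ k, Out k,
    tensor fun k => Matrix.single (w k a) (w k a) (1 : ℂ) ⊗ₖ Matrix.single (a k) (a k) (1 : ℂ)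

/-- The instrument that reads `x` from its classical input, performs the measurement
`(Q_{a|x})_a` and writes the outcome `a` to its classical output:
`M_a = ∑ₓ Q_{a|x} ⊗ |x⟩⟨x| ⊗ |a⟩⟨a|`. -/
def controlled {A Y B : Type*} [Fintype Y] [DecidableEq Y] [DecidableEq B]
    (Q : Y → B → Matrix A A ℂ) (a : B) : Matrix (A × Y × B) (A × Y × B) ℂ :=
  ∑ x, Q x a ⊗ₖ (Matrix.single x x (1 : ℂ) ⊗ₖ Matrix.single a a (1 : ℂ))

end ProcessFunction

end ProcessMatrix

namespace ProcessMatrix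

/-! ### Tensor products of operators and their positivity -/

section Tensor

variable {n : ℕ} {d : Fin n → Type*}

/-! Everything is tested against product operators through `pairing`. A trace-and-replace map on one
party is its own transpose there, so it moves from `W` onto a single factor of the product
(`pairing_constraintMap`). For (1), positivity follows from a factorization of `W`. For the sum, let
`G k` have partial trace `c k • 1` over the output. Its trace-and-replaced version is a scalar `C
k`; expanding each `G k` as `(G k - C k) + C k` gives one term per subset `K`. The process matrix
constraints kill all nonempty `K`, and the trace condition evaluates the remaining term as `∏ c k`
(`IsProcessMatrix.pairing_eq`). The blocks of the summed instruments have this form with `c k` zero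
or one. For (2), pairing with `W_w` is a sum over output tuples of diagonal entries. A function with
constant row sums is a signed mixture of deterministic ones, and each deterministic tuple
contributes exactly one fixed point, so the sum factorizes (`IsProcessFunction.sum_prod_eq`). In a
constraint the row sums of the parties in `K` are zero. -/

theorem tensor_mul [∀ k, Fintype (d k)] (S T : ∀ k, Matrix (d k) (d k) ℂ) :
    tensor S * tensor T = tensor fun k => S k * T k := by
  ext p q
  simp only [tensor, Matrix.mul_apply, Matrix.of_apply]
  rw [Finset.prod_univ_sum]
  simp [Fintype.piFinset_univ, Finset.prod_mul_distrib]

theorem tensor_conjTranspose (T : ∀ k, Matrix (d k) (d k) ℂ) :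
    (tensor T).conjTranspose = tensor fun k => (T k).conjTranspose := by
  ext p q
  simp [tensor, Matrix.conjTranspose_apply]

theorem trace_tensor [∀ k, Fintype (d k)] (T : ∀ k, Matrix (d k) (d k) ℂ) :
    (tensor T).trace = ∏ k, (T k).trace := by
  simp only [Matrix.trace, Matrix.diag_apply, tensor, Matrix.of_apply]
  rw [Finset.prod_univ_sum]
  simp [Fintype.piFinset_univ]

open scoped MatrixOrder in
theorem exists_eq_conjTranspose_mul_self {m : Type*} [Fintype m] [DecidableEq m]
    {M : Matrix m m ℂ} (hM : M.PosSemidef) : ∃ B : Matrix m m ℂ, M = B.conjTranspose * B :=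
  CStarAlgebra.nonneg_iff_eq_star_mul_self.mp hM.nonneg

theorem posSemidef_tensor [∀ k, Fintype (d k)] [∀ k, DecidableEq (d k)]
    {T : ∀ k, Matrix (d k) (d k) ℂ} (hT : ∀ k, (T k).PosSemidef) : (tensor T).PosSemidef := by
  choose B hB using fun k => exists_eq_conjTranspose_mul_self (hT k)
  have : tensor T = (tensor B).conjTranspose * tensor B := by
    rw [tensor_conjTranspose, tensor_mul]
    exact congrArg tensor (funext hB)
  rw [this]
  exact Matrix.posSemidef_conjTranspose_mul_self _

end Tensor

/-! ### Pairing with product operators -/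

section Pairing

variable {n : ℕ} {d : Fin n → Type*}

theorem prod_update_apply (G : ∀ k, Matrix (d k) (d k) ℂ) (k : Fin n) (X : Matrix (d k) (d k) ℂ)
    (p q : ∀ k, d k) :
    ∏ j, Function.update G k X j (p j) (q j)
      = X (p k) (q k) * ∏ j ∈ Finset.univ.erase k, G j (p j) (q j) := by
  rw [← Finset.mul_prod_erase _ _ (Finset.mem_univ k), Function.update_self]
  congr 1
  refine Finset.prod_congr rfl fun j hj => ?_
  rw [Function.update_of_ne (Finset.ne_of_mem_erase hj)]

theorem prod_apply_update (G : ∀ k, Matrix (d k) (d k) ℂ) (k : Fin n) (p q : ∀ k, d k)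
    (r s : d k) :
    ∏ j, G j (Function.update p k r j) (Function.update q k s j)
      = G k r s * ∏ j ∈ Finset.univ.erase k, G j (p j) (q j) := by
  rw [← Finset.mul_prod_erase _ _ (Finset.mem_univ k), Function.update_self, Function.update_self]
  congr 1
  refine Finset.prod_congr rfl fun j hj => ?_
  rw [Function.update_of_ne (Finset.ne_of_mem_erase hj),
    Function.update_of_ne (Finset.ne_of_mem_erase hj)]

variable [∀ k, Fintype (d k)]

/-- The bilinear pairing `Tr [(⨂ₖ Gₖ)ᵀ W]`. -/
noncomputable def pairing (G : ∀ k, Matrix (d k) (d k) ℂ) (W : Matrix (∀ k, d k) (∀ k, d k) ℂ) :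
    ℂ :=
  ∑ p, ∑ q, (∏ k, G k (p k) (q k)) * W p q

theorem pairing_sub (G : ∀ k, Matrix (d k) (d k) ℂ) (V W : Matrix (∀ k, d k) (∀ k, d k) ℂ) :
    pairing G (V - W) = pairing G V - pairing G W := by
  simp [pairing, mul_sub]

theorem pairing_zero (G : ∀ k, Matrix (d k) (d k) ℂ) : pairing G 0 = 0 := by
  simp [pairing]

theorem pairing_update_sub (G : ∀ k, Matrix (d k) (d k) ℂ) (k : Fin n)
    (X Y : Matrix (d k) (d k) ℂ) (W : Matrix (∀ k, d k) (∀ k, d k) ℂ) :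
    pairing (Function.update G k (X - Y)) W
      = pairing (Function.update G k X) W - pairing (Function.update G k Y) W := by
  simp only [pairing, prod_update_apply, Matrix.sub_apply, sub_mul, Finset.sum_sub_distrib]

/-- Exchanging the `k`-th coordinate of `p` with `r` is an involution of the index set. -/
theorem sum_sum_update (k : Fin n) (f : (∀ k, d k) → d k → ℂ) :
    ∑ p, ∑ r, f p r = ∑ p : ∀ k, d k, ∑ r, f (Function.update p k r) (p k) := by
  rw [← Fintype.sum_prod_type', ← Fintype.sum_prod_type']
  let e : (∀ k, d k) × d k → (∀ k, d k) × d k := fun x => (Function.update x.1 k x.2, x.1 k)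
  have he : Function.Involutive e := fun x => by simp [e]
  exact (Equiv.sum_comp (he.toPerm e) fun x => f x.1 x.2).symm

/-- An arbitrary linear map on party `k`, given by its kernel, passes to its transpose on the `k`-th
test factor; both trace-and-replace maps are instances. -/
theorem pairing_kernel (k : Fin n) (κ : d k → d k → d k → d k → ℂ)
    (G : ∀ k, Matrix (d k) (d k) ℂ) (W : Matrix (∀ k, d k) (∀ k, d k) ℂ) :
    pairing G (Matrix.of fun p q => ∑ r, ∑ s, κ (p k) (q k) r s *
        W (Function.update p k r) (Function.update q k s))
      = pairing (Function.update G k (Matrix.of fun r s => ∑ u, ∑ v, κ u v r s * G k u v)) W := by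
  have h1 : pairing G (Matrix.of fun p q => ∑ r, ∑ s, κ (p k) (q k) r s *
        W (Function.update p k r) (Function.update q k s))
      = ∑ p, ∑ r, ∑ q, ∑ s, (∏ j, G j (p j) (q j)) * (κ (p k) (q k) r s *
        W (Function.update p k r) (Function.update q k s)) := by
    simp only [pairing, Matrix.of_apply, Finset.mul_sum]
    refine Finset.sum_congr rfl fun p _ => Finset.sum_comm
  rw [h1, sum_sum_update k]
  simp only [pairing, prod_update_apply, Matrix.of_apply]
  refine Finset.sum_congr rfl fun p _ => ?_
  have h2 (r : d k) := sum_sum_update k fun (q : ∀ k, d k) s =>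
    (∏ j, G j (Function.update p k r j) (q j)) * (κ (Function.update p k r k) (q k) (p k) s *
        W (Function.update (Function.update p k r) k (p k)) (Function.update q k s))
  simp only [h2]
  rw [Finset.sum_comm]
  refine Finset.sum_congr rfl fun q _ => ?_
  simp only [prod_apply_update, Function.update_self, Function.update_idem,
    Function.update_eq_self, Finset.sum_mul]
  refine Finset.sum_congr rfl fun r _ => Finset.sum_congr rfl fun s _ => ?_
  ring

theorem pairing_list_prod (f : Fin n → Module.End ℂ (Matrix (∀ k, d k) (∀ k, d k) ℂ))
    (g : ∀ k, Matrix (d k) (d k) ℂ → Matrix (d k) (d k) ℂ)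
    (hfg : ∀ k G W, pairing G (f k W) = pairing (Function.update G k (g k (G k))) W)
    (L : List (Fin n)) (hL : L.Nodup) (G : ∀ k, Matrix (d k) (d k) ℂ)
    (W : Matrix (∀ k, d k) (∀ k, d k) ℂ) :
    pairing G ((L.map f).prod W) = pairing (fun k => if k ∈ L then g k (G k) else G k) W := by
  induction L generalizing G with
  | nil => simp
  | cons k L ih =>
    rw [List.nodup_cons] at hL
    rw [List.map_cons, List.prod_cons, Module.End.mul_apply, hfg, ih hL.2]
    congr 1
    funext j
    rcases eq_or_ne j k with rfl | hj
    · simp [hL.1]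
    · simp [hj]

theorem pairing_add (C D : ∀ k, Matrix (d k) (d k) ℂ) (W : Matrix (∀ k, d k) (∀ k, d k) ℂ) :
    pairing (fun k => D k + C k) W
      = ∑ K : Finset (Fin n), pairing (fun k => if k ∈ K then D k else C k) W := by
  have h (p q : ∀ k, d k) : ∏ k, (D k + C k) (p k) (q k)
      = ∑ K : Finset (Fin n), ∏ k, (if k ∈ K then D k else C k) (p k) (q k) := by
    simp only [Matrix.add_apply, Fintype.prod_add]
    refine Finset.sum_congr rfl fun K _ => ?_
    rw [← Finset.prod_mul_prod_compl K fun k => (if k ∈ K then D k else C k) (p k) (q k)]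
    congr 1 <;> refine Finset.prod_congr rfl fun k hk => ?_
    · rw [if_pos hk]
    · rw [if_neg (Finset.mem_compl.1 hk)]
  simp only [pairing, h, Finset.sum_mul]
  rw [Finset.sum_comm (s := Finset.univ (α := Finset (Fin n)))]
  exact Finset.sum_congr rfl fun _ _ => Finset.sum_comm

theorem pairing_single [∀ k, DecidableEq (d k)] (p q : ∀ k, d k)
    (W : Matrix (∀ k, d k) (∀ k, d k) ℂ) :
    pairing (fun k => Matrix.single (p k) (q k) 1) W = W p q := by
  have h (p' q' : ∀ k, d k) : ∏ k, Matrix.single (p k) (q k) (1 : ℂ) (p' k) (q' k)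
      = if p = p' ∧ q = q' then 1 else 0 := by
    simp only [Matrix.single_apply, Finset.prod_ite_zero, funext_iff, ← forall_and]
    simp
  simp [pairing, h, ite_and]

end Pairing

/-! ### Trace-and-replace maps and normalization -/

section Parties

variable {n : ℕ} {I O : Fin n → Type*}
  [∀ k, Fintype (I k)] [∀ k, DecidableEq (I k)] [∀ k, Fintype (O k)] [∀ k, DecidableEq (O k)]

/-- Trace-and-replace of the second factor of a bipartite system. -/
noncomputable def replaceOut {X Y : Type*} [Fintype Y] [DecidableEq Y]
    (G : Matrix (X × Y) (X × Y) ℂ) : Matrix (X × Y) (X × Y) ℂ :=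
  Matrix.of fun p q =>
    if p.2 = q.2 then (Fintype.card Y : ℂ)⁻¹ * ∑ o, G (p.1, o) (q.1, o) else 0

/-- Trace-and-replace of the whole system. -/
noncomputable def replaceAll {X : Type*} [Fintype X] [DecidableEq X]
    (G : Matrix X X ℂ) : Matrix X X ℂ :=
  ((Fintype.card X : ℂ)⁻¹ * G.trace) • 1

/-- The kernel is symmetric under exchanging `(u, v)` with `(r, s)`, so the map equals its
transpose. -/
theorem pairing_traceReplaceOut (k : Fin n) (G : ∀ k, Matrix (I k × O k) (I k × O k) ℂ)
    (W : Matrix (∀ j, I j × O j) (∀ j, I j × O j) ℂ) :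
    pairing G (traceReplaceOut k W) = pairing (Function.update G k (replaceOut (G k))) W := by
  convert pairing_kernel k (fun u v r s => if u.2 = v.2 then if u.1 = r.1 then if v.1 = s.1 then
    if r.2 = s.2 then (Fintype.card (O k) : ℂ)⁻¹ else 0 else 0 else 0 else 0) G W using 2
  · ext p q
    by_cases h : (p k).2 = (q k).2
    · simp [traceReplaceOut, h, Fintype.sum_prod_type, Finset.mul_sum, ite_mul, -mul_ite,
        Finset.sum_ite_irrel]
    · simp [traceReplaceOut, h]
  · congr 1
    ext r s
    by_cases h : r.2 = s.2
    · simp [replaceOut, h, Fintype.sum_prod_type, Finset.mul_sum, ite_mul, -mul_ite,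
        Finset.sum_ite_irrel]
    · simp [replaceOut, h]

theorem pairing_traceReplaceInOut (k : Fin n) (G : ∀ k, Matrix (I k × O k) (I k × O k) ℂ)
    (W : Matrix (∀ j, I j × O j) (∀ j, I j × O j) ℂ) :
    pairing G (traceReplaceInOut k W) = pairing (Function.update G k (replaceAll (G k))) W := by
  convert pairing_kernel k (fun u v r s => if u = v then
    if r = s then (Fintype.card (I k × O k) : ℂ)⁻¹ else 0 else 0) G W using 2
  · ext p q
    by_cases h : p k = q k
    · simp [traceReplaceInOut, h, Finset.mul_sum]
    · simp [traceReplaceInOut, h]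
  · congr 1
    ext r s
    by_cases h : r = s
    · simp [replaceAll, h, Finset.mul_sum, Matrix.trace]
    · simp [replaceAll, h]

theorem pairing_constraintMap (K : Finset (Fin n)) (G : ∀ k, Matrix (I k × O k) (I k × O k) ℂ)
    (W : Matrix (∀ j, I j × O j) (∀ j, I j × O j) ℂ) :
    pairing G (constraintMap K W)
      = pairing (fun k => if k ∈ K then G k - replaceOut (G k) else replaceAll (G k)) W := by
  rw [constraintMap, pairing_list_prod _
    (fun k X => if k ∈ K then X - replaceOut X else replaceAll X) _ _ (List.nodup_finRange n)]
  · simp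
  · intro k G W
    by_cases hk : k ∈ K
    · simp [hk, pairing_sub, pairing_update_sub, pairing_traceReplaceOut]
    · simp [hk, pairing_traceReplaceInOut]

theorem replaceOut_of_sum_eq {X Y : Type*} [DecidableEq X] [Fintype Y] [DecidableEq Y]
    {G : Matrix (X × Y) (X × Y) ℂ} {c : ℂ}
    (hG : ∀ x x', ∑ o, G (x, o) (x', o) = if x = x' then c else 0) :
    replaceOut G = ((Fintype.card Y : ℂ)⁻¹ * c) • 1 := by
  ext ⟨x, o⟩ ⟨x', o'⟩
  by_cases h : o = o' <;> by_cases h' : x = x' <;> simp [replaceOut, hG, h, h']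

theorem replaceAll_smul_one {X : Type*} [Fintype X] [DecidableEq X] (c : ℂ) :
    replaceAll (c • (1 : Matrix X X ℂ)) = c • 1 := by
  cases isEmpty_or_nonempty X
  · ext x
    exact isEmptyElim x
  · have : (Fintype.card X : ℂ) ≠ 0 := by exact_mod_cast Fintype.card_ne_zero
    simp only [replaceAll, Matrix.trace_smul, Matrix.trace_one, smul_eq_mul]
    congr 1
    field_simp

theorem pairing_smul_one (c : Fin n → ℂ) (W : Matrix (∀ j, I j × O j) (∀ j, I j × O j) ℂ) :
    pairing (fun k => c k • (1 : Matrix (I k × O k) (I k × O k) ℂ)) W = (∏ k, c k) * W.trace := by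
  have h (p q : ∀ j, I j × O j) :
      ∏ k, (c k • (1 : Matrix (I k × O k) (I k × O k) ℂ)) (p k) (q k)
        = if p = q then ∏ k, c k else 0 := by
    simp only [Matrix.smul_apply, Matrix.one_apply, smul_eq_mul, mul_ite, mul_one, mul_zero,
      Finset.prod_ite_zero, funext_iff]
    simp
  simp only [pairing, h, Matrix.trace, Finset.mul_sum]
  simp

/-- A process matrix is normalized on all products of (blocks of) channels. -/
theorem IsProcessMatrix.pairing_eq [∀ k, Nonempty (O k)]
    {W : Matrix (∀ j, I j × O j) (∀ j, I j × O j) ℂ} (hW : IsProcessMatrix W)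
    (G : ∀ k, Matrix (I k × O k) (I k × O k) ℂ) (c : Fin n → ℂ)
    (hG : ∀ k x x', ∑ o, G k (x, o) (x', o) = if x = x' then c k else 0) :
    pairing G W = ∏ k, c k := by
  let C : ∀ k, Matrix (I k × O k) (I k × O k) ℂ := fun k =>
    ((Fintype.card (O k) : ℂ)⁻¹ * c k) • 1
  have hC (k) : replaceOut (G k) = C k := replaceOut_of_sum_eq (hG k)
  have hGC : G = fun k => (G k - C k) + C k := by simp
  have hcard : ∏ k, (Fintype.card (O k) : ℂ) ≠ 0 :=
    Finset.prod_ne_zero_iff.2 fun k _ => by exact_mod_cast Fintype.card_ne_zero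
  rw [hGC, pairing_add, Finset.sum_eq_single ∅]
  · simp only [Finset.notMem_empty, if_false, C]
    rw [pairing_smul_one, hW.trace_eq, Finset.prod_mul_distrib, Finset.prod_inv_distrib]
    field_simp
  · intro K _ hK
    -- This hybrid family reproduces the `K`-term: `replaceOut` sends `G k` to `C k` on `K`, while
    -- `replaceAll` fixes the scalar `C k` off `K`.
    have h := pairing_constraintMap K (fun k => if k ∈ K then G k else C k) W
    rw [hW.constraint K (Finset.nonempty_iff_ne_empty.2 hK), pairing_zero] at h
    rw [h]
    congr 1
    funext k
    by_cases hk : k ∈ K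
    · simp [hk, hC]
    · simp [hk, C, replaceAll_smul_one]
  · simp

end Parties

/-! ### Effective operators form a POVM -/

section Effective

variable {n : ℕ} {A I O R : Fin n → Type*}
  [∀ k, Fintype (A k)] [∀ k, DecidableEq (A k)] [∀ k, Fintype (I k)] [∀ k, Fintype (O k)]

theorem linkProduct_apply {X Y Z : Type*} [Fintype X] [Fintype Y] [Fintype Z] [DecidableEq X]
    [DecidableEq Z] (M : Matrix (X × Y) (X × Y) ℂ) (N : Matrix (Y × Z) (Y × Z) ℂ) (p q : X × Z) :
    linkProduct M N p q = ∑ y, ∑ y', M (p.1, y') (q.1, y) * N (y', p.2) (y, q.2) := by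
  simp [linkProduct, traceMiddle, Matrix.mul_apply, transposeRight, Fintype.sum_prod_type,
    Matrix.one_apply]

theorem effective_apply (M : ∀ k, R k → Matrix (A k × I k × O k) (A k × I k × O k) ℂ)
    (W : Matrix (∀ j, I j × O j) (∀ j, I j × O j) ℂ) (a : ∀ k, R k) (p q : ∀ k, A k) :
    effective M W a p q
      = pairing (fun k => Matrix.of fun y' y => M k (a k) (p k, y') (q k, y)) W := by
  simp only [effective, Matrix.reindex_apply, Matrix.submatrix_apply, linkProduct_apply]
  rw [Finset.sum_comm]
  rfl

variable [∀ k, DecidableEq (I k)] [∀ k, DecidableEq (O k)]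

theorem posSemidef_effective {M : ∀ k, R k → Matrix (A k × I k × O k) (A k × I k × O k) ℂ}
    {W : Matrix (∀ j, I j × O j) (∀ j, I j × O j) ℂ} (hM : ∀ k a, (M k a).PosSemidef)
    (hW : W.PosSemidef) (a : ∀ k, R k) : (effective M W a).PosSemidef := by
  obtain ⟨B, rfl⟩ := exists_eq_conjTranspose_mul_self hW
  have hD : (distributed M a).PosSemidef := (posSemidef_tensor fun k => hM k (a k)).submatrix _
  -- The identity on the `A` systems tensored with the `i`-th row of `B` as a column vector; summing
  -- the compressions over `i` rebuilds `W`.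
  let C (i : ∀ j, I j × O j) : Matrix ((∀ k, A k) × (∀ j, I j × O j)) (∀ k, A k) ℂ :=
    Matrix.of fun x q => if x.1 = q then B i x.2 else 0
  have : effective M (B.conjTranspose * B) a
      = ∑ i, (C i).conjTranspose * distributed M a * C i := by
    ext p q
    rw [effective_apply]
    simp only [pairing, Matrix.sum_apply, Matrix.mul_apply, Fintype.sum_prod_type,
      Matrix.conjTranspose_apply, Matrix.of_apply, C, apply_ite star, star_zero, ite_mul, mul_ite,
      zero_mul, mul_zero, Finset.sum_ite_irrel, Finset.sum_const_zero, Finset.sum_ite_eq',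
      Finset.mem_univ, if_true]
    simp only [Finset.mul_sum, Finset.sum_mul]
    rw [Finset.sum_comm]
    conv_rhs => rw [Finset.sum_comm]
    refine Finset.sum_congr rfl fun y _ => ?_
    conv_rhs => rw [Finset.sum_comm]
    refine Finset.sum_congr rfl fun y' _ => Finset.sum_congr rfl fun i _ => ?_
    simp only [distributed, tensor, Matrix.submatrix_apply, Matrix.of_apply]
    ring
  rw [this]
  exact Matrix.posSemidef_sum _ fun i _ => hD.conjTranspose_mul_mul_same _

theorem IsProcessMatrix.isPOVM_effective [∀ k, Nonempty (O k)] [∀ k, Fintype (R k)]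
    {W : Matrix (∀ k, I k × O k) (∀ k, I k × O k) ℂ}
    {M : ∀ k, R k → Matrix (A k × I k × O k) (A k × I k × O k) ℂ}
    (hW : IsProcessMatrix W) (hM : ∀ k, IsInstrument (M k)) :
    IsPOVM fun a : ∀ k, R k => effective M W a where
  posSemidef := posSemidef_effective (fun k => (hM k).posSemidef) hW.posSemidef
  sum_eq_one := by
    ext p q
    have h1 : (∑ a : ∀ k, R k, effective M W a) p q
        = pairing (fun k => Matrix.of fun y' y => (∑ a, M k a) (p k, y') (q k, y)) W := by
      simp only [Matrix.sum_apply, effective_apply, pairing, Matrix.of_apply,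
        Finset.prod_univ_sum, Fintype.piFinset_univ, Finset.sum_mul]
      rw [Finset.sum_comm]
      exact Finset.sum_congr rfl fun _ _ => Finset.sum_comm
    -- The `(p k, q k)` blocks need not be positive for `p k ≠ q k`; normalization uses only their
    -- partial traces.
    rw [h1, hW.pairing_eq _ fun k => if p k = q k then 1 else 0]
    · simp only [Matrix.one_apply, Finset.prod_ite_zero, funext_iff]
      simp
    · intro k x x'
      have h := congrFun (congrFun (hM k).traceOut_sum (p k, x)) (q k, x')
      simp only [traceOut, Matrix.of_apply, Matrix.one_apply, Prod.mk.injEq] at h ⊢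
      rw [h]
      split_ifs <;> simp_all

end Effective

/-! ### Process functions and controlled measurements -/

section ProcessFunction

variable {n : ℕ} {A X Out : Fin n → Type*}

/-- A function with constant row sums is a signed mixture of deterministic ones. -/
theorem exists_signed_mixture {Y B : Type*} [Fintype Y] [DecidableEq Y] [Fintype B]
    [DecidableEq B] [Nonempty B] (h : Y → B → ℂ) (s : ℂ) (hs : ∀ y, ∑ b, h y b = s) :
    ∃ μ : (Y → B) → ℂ, ∑ f, μ f = s ∧ ∀ y b, ∑ f, (if f y = b then μ f else 0) = h y b := by
  obtain ⟨b₀⟩ := ‹Nonempty B›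
  let c : Y → B := fun _ => b₀
  let δ (g f : Y → B) : ℂ := if f = g then 1 else 0
  have hδ (g : Y → B) : ∑ f, δ g f = 1 := by simp [δ]
  have hδ' (g : Y → B) (y : Y) (b : B) :
      ∑ f, (if f y = b then δ g f else 0) = if g y = b then 1 else 0 := by
    rw [Finset.sum_eq_single g] <;> simp +contextual [δ]
  -- Changing the constant function `c` at `y` alone affects only row `y`. The differences have
  -- total weight zero, and `s * δ c` cancels the surplus `-s` that they leave at `b₀` in every row.
  refine ⟨fun f => ∑ y, ∑ b, h y b * (δ (Function.update c y b) f - δ c f) + s * δ c f, ?_, ?_⟩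
  · rw [Finset.sum_add_distrib, ← Finset.mul_sum, hδ, mul_one, Finset.sum_comm]
    simp only [Finset.sum_comm (s := (Finset.univ : Finset (Y → B)))]
    simp [← Finset.mul_sum, hδ]
  · intro y b
    have h1 (f : Y → B) : (if f y = b then
        ∑ y, ∑ b, h y b * (δ (Function.update c y b) f - δ c f) + s * δ c f else 0)
        = ∑ y', ∑ b', h y' b' * ((if f y = b then δ (Function.update c y' b') f else 0)
            - (if f y = b then δ c f else 0)) + s * (if f y = b then δ c f else 0) := by
      split_ifs <;> simp
    simp only [h1]
    rw [Finset.sum_add_distrib, ← Finset.mul_sum, hδ', Finset.sum_comm]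
    simp only [Finset.sum_comm (s := (Finset.univ : Finset (Y → B)))]
    simp only [← Finset.mul_sum, Finset.sum_sub_distrib, hδ']
    rw [Finset.sum_eq_single y]
    · simp [mul_sub, hs, c]
    · intro y' _ hy'
      simp [Function.update_of_ne hy'.symm, c]
    · simp

/-- Applying `f` to an input fixed point gives an output fixed point, and `w` maps back. -/
theorem IsProcessFunction.existsUnique_output {w : ∀ k, (∀ j, Out j) → X k}
    (hw : IsProcessFunction w) (f : ∀ k, X k → Out k) :
    ∃! a : ∀ k, Out k, ∀ k, f k (w k a) = a k := by
  obtain ⟨x, hx, hu⟩ := hw f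
  refine ⟨fun k => f k (x k), fun k => by rw [hx k], fun a ha => ?_⟩
  have : (fun k => w k a) = x := hu _ fun k => by simp only [ha]
  funext k
  rw [← this, ha k]

variable [∀ k, Fintype (X k)] [∀ k, DecidableEq (X k)] [∀ k, Fintype (Out k)] [∀ k, DecidableEq (Out k)]

theorem IsProcessFunction.sum_prod_eq [∀ k, Nonempty (Out k)] {w : ∀ k, (∀ j, Out j) → X k}
    (hw : IsProcessFunction w) (h : ∀ k, X k → Out k → ℂ) (s : Fin n → ℂ)
    (hs : ∀ k x, ∑ b, h k x b = s k) :
    ∑ a : ∀ k, Out k, ∏ k, h k (w k a) (a k) = ∏ k, s k := by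
  choose μ hμ hμ' using fun k => exists_signed_mixture (h k) (s k) (hs k)
  simp only [← hμ, ← hμ', Finset.prod_univ_sum, Fintype.piFinset_univ]
  rw [Finset.sum_comm]
  refine Finset.sum_congr rfl fun f _ => ?_
  obtain ⟨a, ha, hu⟩ := hw.existsUnique_output f
  rw [Finset.sum_eq_single a]
  · exact Finset.prod_congr rfl fun k _ => if_pos (ha k)
  · intro b _ hb
    obtain ⟨k, hk⟩ := not_forall.1 (mt (hu b) hb)
    exact Finset.prod_eq_zero (Finset.mem_univ k) (if_neg hk)
  · simp

theorem pairing_ofFunction (w : ∀ k, (∀ j, Out j) → X k)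
    (G : ∀ k, Matrix (X k × Out k) (X k × Out k) ℂ) :
    pairing G (ofFunction w) = ∑ a, ∏ k, G k (w k a, a k) (w k a, a k) := by
  have h (a : ∀ k, Out k) (p q : ∀ k, X k × Out k) :
      tensor (fun k => Matrix.single (w k a) (w k a) (1 : ℂ) ⊗ₖ
        Matrix.single (a k) (a k) (1 : ℂ)) p q
      = if (fun k => (w k a, a k)) = p then if (fun k => (w k a, a k)) = q then 1 else 0 else 0 := by
    simp only [tensor, Matrix.of_apply, Matrix.single_kronecker_single, mul_one,
      Matrix.single_apply, Finset.prod_ite_zero, ← ite_and, funext_iff, ← forall_and]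
    simp
  simp only [pairing, ofFunction, Matrix.sum_apply, h, Finset.mul_sum]
  simp only [Finset.sum_comm (t := Finset.univ (α := ∀ k, Out k))]
  simp

theorem posSemidef_single {m : Type*} [DecidableEq m] (x : m) :
    (Matrix.single x x (1 : ℂ)).PosSemidef := by
  rw [← Matrix.diagonal_single]
  exact Matrix.PosSemidef.diagonal (Pi.single_nonneg.2 zero_le_one)

theorem IsProcessFunction.isProcessMatrix [∀ k, Nonempty (Out k)]
    {w : ∀ k, (∀ j, Out j) → X k} (hw : IsProcessFunction w) :
    IsProcessMatrix (ofFunction w) where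
  posSemidef := Matrix.posSemidef_sum _ fun a _ =>
    posSemidef_tensor fun k => (posSemidef_single _).kronecker (posSemidef_single _)
  trace_eq := by
    simp [ofFunction, Matrix.trace_sum, trace_tensor, Matrix.trace_kronecker]
  constraint K hK := by
    ext p q
    rw [← pairing_single p q (constraintMap K (ofFunction w)), pairing_constraintMap, pairing_ofFunction]
    set G : ∀ k, Matrix (X k × Out k) (X k × Out k) ℂ := fun k => Matrix.single (p k) (q k) 1
    obtain ⟨k₀, hk₀⟩ := hK
    -- Trace-and-replace preserves the trace over the output, so rows vanish for `k ∈ K`; otherwise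
    -- the replaced factor is scalar and its rows have equal sums.
    have := hw.sum_prod_eq (fun k x b =>
      (if k ∈ K then G k - replaceOut (G k) else replaceAll (G k)) (x, b) (x, b))
      (fun k => if k ∈ K then 0 else
        Fintype.card (Out k) * ((Fintype.card (X k × Out k) : ℂ)⁻¹ * (G k).trace)) ?_
    · rw [this, Matrix.zero_apply]
      exact Finset.prod_eq_zero (Finset.mem_univ k₀) (if_pos hk₀)
    · intro k x
      by_cases hk : k ∈ K
      · simp [hk, replaceOut]
      · simp [hk, replaceAll]

theorem controlled_apply {A Y B : Type*} [Fintype Y] [DecidableEq Y] [DecidableEq B]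
    (Q : Y → B → Matrix A A ℂ) (a : B) (p q : A × Y × B) :
    controlled Q a p q
      = if p.2.1 = q.2.1 then if a = p.2.2 then if a = q.2.2 then Q p.2.1 a p.1 q.1
        else 0 else 0 else 0 := by
  obtain ⟨p, y, b⟩ := p
  obtain ⟨q, y', b'⟩ := q
  simp only [controlled, Matrix.sum_apply, Matrix.kronecker_apply, Matrix.single_apply]
  rw [Finset.sum_eq_single y]
  · by_cases h1 : y = y' <;> by_cases h2 : a = b <;> by_cases h3 : a = b' <;> simp [h1, h2, h3]
  · intro z _ hz
    simp [hz]
  · simp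

theorem isInstrument_controlled {A Y B : Type*} [Fintype A] [DecidableEq A] [Fintype Y]
    [DecidableEq Y] [Fintype B] [DecidableEq B] {Q : Y → B → Matrix A A ℂ}
    (hQ : ∀ y, IsPOVM (Q y)) : IsInstrument (controlled Q) where
  posSemidef a := Matrix.posSemidef_sum _ fun x _ =>
    ((hQ x).posSemidef a).kronecker ((posSemidef_single _).kronecker (posSemidef_single _))
  traceOut_sum := by
    ext ⟨p, y⟩ ⟨q, y'⟩
    have h := congrFun (congrFun (hQ y).sum_eq_one p) q
    simp only [Matrix.sum_apply] at h
    by_cases hy : y = y'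
    · simp [traceOut, Matrix.sum_apply, controlled_apply, hy]
      subst hy
      rw [h]
      simp [Matrix.one_apply]
    · simp [traceOut, Matrix.sum_apply, controlled_apply, hy]

theorem effective_controlled_ofFunction [∀ k, Fintype (A k)] [∀ k, DecidableEq (A k)]
    (w : ∀ k, (∀ j, Out j) → X k) (Q : ∀ k, X k → Out k → Matrix (A k) (A k) ℂ)
    (a : ∀ k, Out k) :
    effective (fun k => controlled (Q k)) (ofFunction w) a
      = tensor fun k => Q k (w k a) (a k) := by
  ext p q
  rw [effective_apply, pairing_ofFunction, Finset.sum_eq_single a]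
  · simp [controlled_apply, tensor]
  · intro b _ hb
    obtain ⟨k, hk⟩ := Function.ne_iff.1 hb
    exact Finset.prod_eq_zero (Finset.mem_univ k) (by simp [controlled_apply, hk.symm])
  · simp

end ProcessFunction

end ProcessMatrix

theorem theorem5 {n : ℕ} (A I O : Fin n → Type*)
    [∀ k, Fintype (A k)] [∀ k, DecidableEq (A k)]
    [∀ k, Fintype (I k)] [∀ k, DecidableEq (I k)]
    [∀ k, Fintype (O k)] [∀ k, DecidableEq (O k)] [∀ k, Nonempty (O k)] :
    (∀ (R : Fin n → Type*) [∀ k, Fintype (R k)]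
        (W : Matrix (∀ k, I k × O k) (∀ k, I k × O k) ℂ)
        (M : ∀ k, R k → Matrix (A k × I k × O k) (A k × I k × O k) ℂ),
        ProcessMatrix.IsProcessMatrix W →
        (∀ k, ProcessMatrix.IsInstrument (M k)) →
        ProcessMatrix.IsPOVM (fun a : ∀ k, R k => ProcessMatrix.effective M W a)) ∧
    (∀ w : ∀ k, (∀ j, O j) → I k, ProcessMatrix.IsProcessFunction w →
        ProcessMatrix.IsProcessMatrix (ProcessMatrix.ofFunction w) ∧
        ∀ Q : ∀ k, I k → O k → Matrix (A k) (A k) ℂ,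
          (∀ k x, ProcessMatrix.IsPVM (Q k x)) →
          (∀ k, ProcessMatrix.IsInstrument (ProcessMatrix.controlled (Q k))) ∧
          (∀ a : ∀ k, O k,
            ProcessMatrix.effective (fun k => ProcessMatrix.controlled (Q k))
                (ProcessMatrix.ofFunction w) a =
              ProcessMatrix.tensor (fun k => Q k (w k a) (a k))) ∧
          ProcessMatrix.IsPVM (fun a : ∀ k, O k =>
            ProcessMatrix.effective (fun k => ProcessMatrix.controlled (Q k))
              (ProcessMatrix.ofFunction w) a)) := by
  refine ⟨fun R _ W M hW hM => hW.isPOVM_effective hM, fun w hw => ⟨hw.isProcessMatrix, ?_⟩⟩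
  intro Q hQ
  have hI (k) : ProcessMatrix.IsInstrument (ProcessMatrix.controlled (Q k)) :=
    ProcessMatrix.isInstrument_controlled fun x => (hQ k x).toIsPOVM
  have hE := ProcessMatrix.effective_controlled_ofFunction w Q
  refine ⟨hI, hE, hw.isProcessMatrix.isPOVM_effective hI, fun a => ?_⟩
  rw [hE, ProcessMatrix.tensor_mul]
  exact congrArg ProcessMatrix.tensor (funext fun k => (hQ k _).idempotent _)
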